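/- Let $(X,\mathcal B,\mu)$ be a probability space and let $T:X\to X$ be an invertible bimeasurable measure-preserving transformation (for instance, an ergodic one). Denote also by $T$ the unitary Koopman operator $Tf=f\circ T$ on the complex Hilbert space $L_2(X,\mathcal B,\mu)$. An eigenfunction of $T$ is a nonzero $f\in L_2$ with $Tf=\lambda f$ for some $\lambda\in\mathbb C$; a compact function is an $f\in L_2$ whose orbit $\{T^if: i\in\mathbb Z\}$ is precompact in $L_2$. The Kronecker algebra $\mathcal K\subset\mathcal B$ is the smallest $\sigma$-algebra with respect to which all eigenfunctions are measurable, and the compact factor $\mathcal K'\subset\mathcal B$ is the $\sigma$-algebra generated by all compact functions. (Elements of $L_2$ are defined up to null sets; in both definitions all $\mathcal B$-measurable representatives are taken, so that both $\sigma$-algebras contain all null sets of $\mathcal B$.) Then the compact factor coincides with the Kronecker algebra, $\mathcal K=\mathcal K'$. Moreover, the compact functions are exactly the elements of the closed linear span of the eigenfunctions in $L_2$. -/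

import Mathlib

open MeasureTheory

namespace Kronecker

variable {X : Type*} [MeasurableSpace X] {μ : Measure X}

theorem compMeasurePreserving_comp_cancel (S T : X → X) (hS : MeasurePreserving S μ μ)
    (hT : MeasurePreserving T μ μ) (h : ∀ x, S (T x) = x) (f : Lp ℂ 2 μ) :
    Lp.compMeasurePreserving T hT (Lp.compMeasurePreserving S hS f) = f := by
  apply Lp.ext
  have h1 := Lp.coeFn_compMeasurePreserving (Lp.compMeasurePreserving S hS f) hT
  have h2 := hT.quasiMeasurePreserving.ae_eq_comp (Lp.coeFn_compMeasurePreserving f hS)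
  filter_upwards [h1, h2] with x hx1 hx2
  rw [hx1, hx2]
  simp [h]

/-- The Koopman operator `f ↦ f ∘ T` of an invertible measure-preserving transformation, as a
unitary operator on the complex Hilbert space `L²(X, μ)`. -/
noncomputable def koopman (T : X ≃ᵐ X) (hT : MeasurePreserving T μ μ) :
    Lp ℂ 2 μ ≃ₗᵢ[ℂ] Lp ℂ 2 μ where
  toFun := Lp.compMeasurePreserving T hT
  invFun := Lp.compMeasurePreserving T.symm (hT.symm T)
  map_add' := map_add _
  map_smul' := (Lp.compMeasurePreservingₗ ℂ T hT).map_smul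
  left_inv := compMeasurePreserving_comp_cancel _ _ _ _ T.apply_symm_apply
  right_inv := compMeasurePreserving_comp_cancel _ _ _ _ T.symm_apply_apply
  norm_map' f := Lp.norm_compMeasurePreserving f hT

/-- The (nonzero) eigenvectors of the Koopman operator, for all eigenvalues. -/
def eigenvectors (T : X ≃ᵐ X) (hT : MeasurePreserving T μ μ) : Set (Lp ℂ 2 μ) :=
  {f | f ≠ 0 ∧ ∃ c : ℂ, koopman T hT f = c • f}

/-- The compact vectors: those `f ∈ L²` whose orbit `{Tⁱ f : i ∈ ℤ}` is precompact in `L²`. -/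
def compactVectors (T : X ≃ᵐ X) (hT : MeasurePreserving T μ μ) : Set (Lp ℂ 2 μ) :=
  {f | IsCompact (closure (Set.range fun i : ℤ => (koopman T hT ^ i) f))}

/-- The σ-algebra generated by a set `S` of elements of `L²`. As elements of `L²` are classes of
functions modulo null sets, this is the smallest σ-algebra for which every measurable function
representing an element of `S` is measurable. (It is contained in the ambient σ-algebra and, if `S`
is nonempty, it contains all its null sets.) -/
@[reducible]
noncomputable def generatedBy (S : Set (Lp ℂ 2 μ)) : MeasurableSpace X :=
  ⨆ g ∈ {g : X → ℂ | Measurable g ∧ ∃ f ∈ S, g =ᵐ[μ] f}, MeasurableSpace.comap g inferInstance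

/-- The Kronecker algebra: the smallest σ-algebra making all eigenfunctions measurable. -/
@[reducible]
noncomputable def kroneckerAlgebra (T : X ≃ᵐ X) (hT : MeasurePreserving T μ μ) : MeasurableSpace X :=
  generatedBy (eigenvectors T hT)

/-- The compact factor: the σ-algebra generated by the compact functions. -/
@[reducible]
noncomputable def compactFactor (T : X ≃ᵐ X) (hT : MeasurePreserving T μ μ) : MeasurableSpace X :=
  generatedBy (compactVectors T hT)

end Kronecker

/-! The eigenfunctions of a Koopman operator `U` are compact, and compact functions form a closed
subspace, so the point is that a nonzero compact function `g` is never orthogonal to all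
eigenfunctions. The rank-one operators `⟪y, ·⟫ y`, with `y` in the closure of the orbit of `g`, form
a compact set which is invariant under conjugation by `U`; hence conjugation fixes a point `A` of
its closed convex hull. This `A` is a compact self-adjoint operator commuting with `U`, and it is
nonzero because it is an average of nonzero positive operators. A nonzero eigenvalue of `A` has a
finite-dimensional eigenspace, in which `U` has an eigenvector `v`; as `A v ≠ 0`, some point of the
orbit of `g`, and hence `g` itself, is not orthogonal to `v`.

For the σ-algebras, measurability modulo null sets passes to linear combinations and to limits in
`L²`, and a σ-algebra generated by at least one class in `L²` contains all null sets. -/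

open Filter InnerProductSpace Kronecker Set Topology

section Convex

theorem birkhoffAverage_mem_of_convex {α E : Type*} [AddCommGroup E] [Module ℝ E] {s : Set E}
    (hs : Convex ℝ s) {f : α → α} {g : α → E} {x : α} (hg : ∀ k, g (f^[k] x) ∈ s) {n : ℕ}
    (hn : n ≠ 0) : birkhoffAverage ℝ f g n x ∈ s := by
  rw [birkhoffAverage, birkhoffSum, Finset.smul_sum]
  refine hs.sum_mem (fun _ _ => by positivity) ?_ fun k _ => hg k
  rw [Finset.sum_const, Finset.card_range, nsmul_eq_mul, mul_inv_cancel₀ (mod_cast hn)]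

variable {E : Type*} [AddCommGroup E] [Module ℝ E] [TopologicalSpace E]

theorem mapsTo_closedConvexHull (φ : E →L[ℝ] E) {s : Set E} (h : MapsTo φ s s) :
    MapsTo φ (closedConvexHull ℝ s) (closedConvexHull ℝ s) :=
  closedConvexHull_min (h.mono_right subset_closedConvexHull)
    (convex_closedConvexHull.linear_preimage φ.toLinearMap)
    (isClosed_closedConvexHull.preimage φ.continuous)

theorem closedConvexHull_subset_submodule {s : Set E} {W : Submodule ℝ E}
    (hW : IsClosed (W : Set E)) (h : s ⊆ W) : closedConvexHull ℝ s ⊆ W :=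
  closedConvexHull_min h W.convex hW

end Convex

section FixedPoint

variable {E : Type*} [NormedAddCommGroup E] [NormedSpace ℝ E]

theorem exists_mem_apply_eq_self_of_isCompact_of_convex (φ : E →L[ℝ] E) {K : Set E}
    (hK : IsCompact K) (hconv : Convex ℝ K) (hne : K.Nonempty) (hφ : MapsTo φ K K) :
    ∃ x ∈ K, φ x = x := by
  obtain ⟨x, hx⟩ := hne
  let a (n : ℕ) : E := birkhoffAverage ℝ φ id (n + 1) x
  have horbit (n : ℕ) : φ^[n] x ∈ K := hφ.iterate n hx
  have ha (n : ℕ) : a n ∈ K := birkhoffAverage_mem_of_convex hconv horbit n.succ_ne_zero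
  have hφa (n : ℕ) : φ (a n) = birkhoffAverage ℝ φ id (n + 1) (φ x) := by
    simp only [a, birkhoffAverage, birkhoffSum, map_smul, map_sum, id_eq,
      ← Function.iterate_succ_apply', Function.iterate_succ_apply]
  have hdiff : Tendsto (fun n => φ (a n) - a n) atTop (𝓝 0) := by
    simp only [hφa]
    exact (tendsto_birkhoffAverage_apply_sub_birkhoffAverage ℝ
      (hK.isBounded.subset (range_subset_iff.2 horbit))).comp (tendsto_add_atTop_nat 1)
  obtain ⟨y, hy, ψ, hψ, hlim⟩ := hK.tendsto_subseq ha
  refine ⟨y, hy, sub_eq_zero.1 (tendsto_nhds_unique ?_ (hdiff.comp hψ.tendsto_atTop))⟩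
  exact ((φ.continuous.tendsto y).comp hlim).sub hlim

theorem isCompact_closedConvexHull [CompleteSpace E] {s : Set E} (hs : IsCompact s) :
    IsCompact (closedConvexHull ℝ s) := by
  rw [closedConvexHull_eq_closure_convexHull]
  exact hs.totallyBounded.convexHull.closure.isCompact_of_isClosed isClosed_closure

end FixedPoint

section Operators

section RankOne

variable {𝕜 E F : Type*} [RCLike 𝕜] [NormedAddCommGroup E] [NormedSpace 𝕜 E]
  [NormedAddCommGroup F] [InnerProductSpace 𝕜 F]

theorem continuous_rankOne_self : Continuous fun y : F => rankOne 𝕜 y y := by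
  simp only [rankOne_def]
  fun_prop

theorem isCompactOperator_rankOne (x : E) (y : F) : IsCompactOperator (rankOne 𝕜 x y) :=
  (isCompactOperator_of_locallyCompactSpace_dom (innerSL 𝕜 y)).clm_comp (.toSpanSingleton 𝕜 x)

end RankOne

variable {H : Type*} [NormedAddCommGroup H] [InnerProductSpace ℂ H]

-- Finitely many quadratic forms `A ↦ re ⟪y, A y⟫` have a sum that is positive on all of `C`, hence
-- bounded below on its closed convex hull.
theorem zero_notMem_closedConvexHull_of_isPositive {C : Set (H →L[ℂ] H)} (hC : IsCompact C)
    (hpos : ∀ A ∈ C, A.IsPositive) (h0 : 0 ∉ C) : 0 ∉ closedConvexHull ℝ C := by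
  let q (y : H) : (H →L[ℂ] H) →L[ℝ] ℝ :=
    Complex.reCLM ∘L ((innerSL ℂ y) ∘L (ContinuousLinearMap.apply ℂ H y)).restrictScalars ℝ
  have hq (A : H →L[ℂ] H) (y : H) : q y A = (inner ℂ y (A y)).re := rfl
  have hq_nonneg (A : H →L[ℂ] H) (hA : A ∈ C) (y : H) : 0 ≤ q y A :=
    (hpos A hA).re_inner_nonneg_right y
  have hcover : C ⊆ ⋃ y, {A | 0 < q y A} := by
    intro A hA
    obtain ⟨y, hy⟩ := (hpos A hA).toLinearMap.ne_zero_iff.1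
      (ContinuousLinearMap.coe_injective.ne (ne_of_mem_of_not_mem hA h0))
    refine mem_iUnion.2 ⟨y, ?_⟩
    rw [mem_ofPred_eq, hq, ← (hpos A hA).inner_left_eq_inner_right]
    exact (Complex.pos_iff.1 hy).1
  obtain ⟨t, ht⟩ := hC.elim_finite_subcover _
    (fun y => isOpen_lt continuous_const (q y).continuous) hcover
  let Q : (H →L[ℂ] H) →L[ℝ] ℝ := ∑ y ∈ t, q y
  have hQ (A : H →L[ℂ] H) (hA : A ∈ C) : 0 < Q A := by
    obtain ⟨y, hy, hyA⟩ := mem_iUnion₂.1 (ht hA)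
    rw [sum_apply]
    exact Finset.sum_pos' (fun y _ => hq_nonneg A hA y) ⟨y, hy, hyA⟩
  obtain ⟨δ, hδ, hδC⟩ := hC.exists_forall_le' Q.continuous.continuousOn hQ
  have hhull : closedConvexHull ℝ C ⊆ {A | δ ≤ Q A} :=
    closedConvexHull_min hδC (convex_halfSpace_ge Q.toLinearMap.isLinear δ)
      (isClosed_le continuous_const Q.continuous)
  intro hmem
  exact hδ.not_ge (by simpa using hhull hmem)

/-- The closed convex hull of the rank-one operators `⟪y, ·⟫ y` with `y ∈ S`, that is, the possible
averages of these operators. -/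
noncomputable def rankOneHull (S : Set H) : Set (H →L[ℂ] H) :=
  closedConvexHull ℝ ((fun y => rankOne ℂ y y) '' S)

theorem rankOneHull_subset_submodule {S : Set H} {W : Submodule ℂ (H →L[ℂ] H)}
    (hW : IsClosed (W : Set (H →L[ℂ] H))) (h : ∀ y ∈ S, rankOne ℂ y y ∈ W) : rankOneHull S ⊆ W :=
  closedConvexHull_subset_submodule (W := W.restrictScalars ℝ) hW (image_subset_iff.2 h)

theorem isCompactOperator_of_mem_rankOneHull [CompleteSpace H] {S : Set H} {A : H →L[ℂ] H}
    (hA : A ∈ rankOneHull S) : IsCompactOperator A :=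
  rankOneHull_subset_submodule (W := compactOperator (RingHom.id ℂ) H H)
    isClosed_setOfPred_isCompactOperator (fun y _ => isCompactOperator_rankOne y y) hA

theorem isSelfAdjoint_of_mem_rankOneHull [CompleteSpace H] {S : Set H} {A : H →L[ℂ] H}
    (hA : A ∈ rankOneHull S) : IsSelfAdjoint A := by
  refine closedConvexHull_subset_submodule (W := selfAdjoint.submodule ℝ (H →L[ℂ] H)) ?_ ?_ hA
  · exact isClosed_eq continuous_star continuous_id
  · rintro _ ⟨y, -, rfl⟩
    exact (isPositive_rankOne_self y).isSelfAdjoint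

theorem apply_eq_zero_of_mem_rankOneHull {S : Set H} {A : H →L[ℂ] H} (hA : A ∈ rankOneHull S)
    {v : H} (hv : ∀ y ∈ S, inner ℂ y v = 0) : A v = 0 :=
  rankOneHull_subset_submodule (W := (ContinuousLinearMap.apply ℂ H v).ker)
    (ContinuousLinearMap.isClosed_ker _) (fun y hy => by simp [hv y hy]) hA

theorem zero_notMem_rankOneHull {S : Set H} (hS : IsCompact S) (h0 : 0 ∉ S) :
    0 ∉ rankOneHull S := by
  refine zero_notMem_closedConvexHull_of_isPositive (hS.image continuous_rankOne_self) ?_ ?_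
  · rintro _ ⟨y, -, rfl⟩
    exact isPositive_rankOne_self y
  · rintro ⟨y, hy, hy0⟩
    obtain rfl : y = 0 := by simpa using hy0
    exact h0 hy

theorem exists_mem_rankOneHull_commute [CompleteSpace H] (U : H ≃ₗᵢ[ℂ] H) {S : Set H}
    (hS : IsCompact S) (hne : S.Nonempty) (hU : MapsTo U S S) :
    ∃ A ∈ rankOneHull S, ∀ x, A (U x) = U (A x) := by
  let e := U.toContinuousLinearEquiv
  let conj : (H →L[ℂ] H) →L[ℝ] (H →L[ℂ] H) :=
    (e.arrowCongr e).toContinuousLinearMap.restrictScalars ℝ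
  have hconj (A : H →L[ℂ] H) (x : H) : conj A x = U (A (U.symm x)) := rfl
  have hrank (y : H) : conj (rankOne ℂ y y) = rankOne ℂ (U y) (U y) := by
    ext x
    rw [hconj, rankOne_apply, rankOne_apply, map_smul, ← U.inner_map_map, U.apply_symm_apply]
  have hmaps : MapsTo conj ((fun y => rankOne ℂ y y) '' S) ((fun y => rankOne ℂ y y) '' S) := by
    rintro _ ⟨y, hy, rfl⟩
    exact ⟨U y, hU hy, (hrank y).symm⟩
  obtain ⟨A, hA, hfix⟩ := exists_mem_apply_eq_self_of_isCompact_of_convex conj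
    (isCompact_closedConvexHull (hS.image continuous_rankOne_self)) convex_closedConvexHull
    ((hne.image _).mono subset_closedConvexHull) (mapsTo_closedConvexHull conj hmaps)
  refine ⟨A, hA, fun x => ?_⟩
  rw [← DFunLike.congr_fun hfix (U x), hconj, U.symm_apply_apply]

theorem exists_common_eigenvector [CompleteSpace H] {A : H →L[ℂ] H} (hA : IsCompactOperator A)
    (hsymm : A.IsSymmetric) (hA0 : A ≠ 0) {B : Module.End ℂ H}
    (hAB : Commute (A : Module.End ℂ H) B) :
    ∃ v, A v ≠ 0 ∧ ∃ c : ℂ, B v = c • v := by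
  obtain ⟨a, ha, ha0⟩ : ∃ a, Module.End.HasEigenvalue (A : Module.End ℂ H) a ∧ a ≠ 0 := by
    by_contra! h
    exact hA0 ((ContinuousLinearMap.eq_zero_of_forall_hasEigenvalue_eq_zero hA hsymm).1 h)
  have : FiniteDimensional ℂ (Module.End.eigenspace (A : Module.End ℂ H) a) :=
    ContinuousLinearMap.finite_dimensional_eigenspace hA a ha0
  have : Nontrivial (Module.End.eigenspace (A : Module.End ℂ H) a) :=
    Submodule.nontrivial_iff_ne_bot.2 ha
  obtain ⟨c, hc⟩ := Module.End.exists_eigenvalue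
    (B.restrict (Module.End.mapsTo_genEigenspace_of_comm hAB a 1))
  obtain ⟨v, hv⟩ := hc.exists_hasEigenvector
  have hAv : A v = a • (v : H) := Module.End.mem_eigenspace_iff.1 v.2
  refine ⟨v, ?_, c, congrArg Subtype.val hv.apply_eq_smul⟩
  rw [hAv]
  exact smul_ne_zero ha0 (Subtype.coe_ne_coe.2 hv.2)

end Operators

section AlmostPeriodic

section NormedSpace

variable {𝕜 E : Type*} [NormedField 𝕜] [NormedAddCommGroup E] [NormedSpace 𝕜 E]
  {U : E ≃ₗᵢ[𝕜] E} {f : E} {c : 𝕜}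

theorem norm_eq_one_of_apply_eq_smul (hf : f ≠ 0) (h : U f = c • f) : ‖c‖ = 1 := by
  have := U.norm_map f
  rwa [h, norm_smul, mul_eq_right₀ (norm_ne_zero_iff.2 hf)] at this

theorem zpow_apply_eq_smul (hc : c ≠ 0) (h : U f = c • f) (i : ℤ) : (U ^ i) f = c ^ i • f := by
  have hinv : U⁻¹ f = c⁻¹ • f := U.symm_apply_eq.2 (by rw [map_smul, h, inv_smul_smul₀ hc])
  induction i with
  | zero => simp
  | succ n ih =>
    rw [zpow_add_one, zpow_add_one₀ hc, LinearIsometryEquiv.coe_mul, Function.comp_apply, h,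
      map_smul, ih, smul_smul, mul_comm]
  | pred n ih =>
    rw [zpow_sub_one, zpow_sub_one₀ hc, LinearIsometryEquiv.coe_mul, Function.comp_apply, hinv,
      map_smul, ih, smul_smul, mul_comm]

variable (U) in
/-- The almost periodic vectors of a linear isometric automorphism `U`: those whose orbit under the
powers of `U` is precompact. For a Koopman operator these are the compact functions. -/
def almostPeriodicVectors : Submodule 𝕜 E where
  carrier := {f | IsCompact (closure (range fun i : ℤ => (U ^ i) f))}
  zero_mem' := by simp
  add_mem' {f g} hf hg := by
    refine (hf.add hg).closure_of_subset ?_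
    rintro _ ⟨i, rfl⟩
    exact ⟨(U ^ i) f, subset_closure ⟨i, rfl⟩, (U ^ i) g, subset_closure ⟨i, rfl⟩,
      (map_add _ _ _).symm⟩
  smul_mem' c f hf := by
    refine (hf.image (continuous_const_smul c)).closure_of_subset ?_
    rintro _ ⟨i, rfl⟩
    exact ⟨(U ^ i) f, subset_closure ⟨i, rfl⟩, (map_smul _ _ _).symm⟩

theorem isClosed_almostPeriodicVectors [CompleteSpace E] :
    IsClosed (almostPeriodicVectors U : Set E) := by
  refine isClosed_of_closure_subset fun f hf => ?_
  suffices h : TotallyBounded (range fun i : ℤ => (U ^ i) f) from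
    h.closure.isCompact_of_isClosed isClosed_closure
  refine Metric.totallyBounded_iff.2 fun ε hε => ?_
  obtain ⟨g, hg, hfg⟩ := Metric.mem_closure_iff.1 hf (ε / 2) (half_pos hε)
  obtain ⟨t, ht, hcover⟩ := Metric.totallyBounded_iff.1 (IsCompact.totallyBounded hg)
    (ε / 2) (half_pos hε)
  refine ⟨t, ht, range_subset_iff.2 fun i => ?_⟩
  obtain ⟨y, hy, hgy⟩ := mem_iUnion₂.1 (hcover (subset_closure ⟨i, rfl⟩))
  refine mem_iUnion₂.2 ⟨y, hy, ?_⟩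
  calc dist ((U ^ i) f) y ≤ dist ((U ^ i) f) ((U ^ i) g) + dist ((U ^ i) g) y :=
        dist_triangle _ _ _
    _ < ε / 2 + ε / 2 := add_lt_add (by rwa [(U ^ i).dist_map]) hgy
    _ = ε := add_halves ε

theorem mem_almostPeriodicVectors_of_apply_eq_smul [ProperSpace 𝕜] (h : U f = c • f) :
    f ∈ almostPeriodicVectors U := by
  obtain rfl | hf := eq_or_ne f 0
  · exact zero_mem _
  have hc : ‖c‖ = 1 := norm_eq_one_of_apply_eq_smul hf h
  have hsphere : IsCompact ((fun z : 𝕜 => z • f) '' Metric.sphere 0 1) :=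
    (isCompact_sphere 0 1).image (continuous_id.smul continuous_const)
  refine hsphere.closure_of_subset (range_subset_iff.2 fun i => ⟨c ^ i, by simp [hc], ?_⟩)
  exact (zpow_apply_eq_smul (norm_ne_zero_iff.1 (by simp [hc])) h i).symm

theorem mapsTo_closure_orbit (U : E ≃ₗᵢ[𝕜] E) (f : E) :
    MapsTo U (closure (range fun i : ℤ => (U ^ i) f)) (closure (range fun i : ℤ => (U ^ i) f)) := by
  refine MapsTo.closure ?_ U.continuous
  rintro _ ⟨i, rfl⟩
  exact ⟨1 + i, by simp [zpow_one_add]⟩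

theorem norm_eq_of_mem_closure_orbit {y : E} (hy : y ∈ closure (range fun i : ℤ => (U ^ i) f)) :
    ‖y‖ = ‖f‖ :=
  closure_minimal (t := {y | ‖y‖ = ‖f‖}) (range_subset_iff.2 fun i => (U ^ i).norm_map f)
    (isClosed_eq continuous_norm continuous_const) hy

end NormedSpace

variable {H : Type*} [NormedAddCommGroup H] [InnerProductSpace ℂ H]

theorem inner_eq_zero_of_mem_closure_orbit {U : H ≃ₗᵢ[ℂ] H} {g v y : H} {c : ℂ} (hv : U v = c • v)
    (hgv : inner ℂ g v = 0) (hy : y ∈ closure (range fun i : ℤ => (U ^ i) g)) :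
    inner ℂ y v = 0 := by
  obtain rfl | hv0 := eq_or_ne v 0
  · exact inner_zero_right y
  have hc : c ≠ 0 := norm_ne_zero_iff.1 (by simp [norm_eq_one_of_apply_eq_smul hv0 hv])
  refine closure_minimal (t := {y | inner ℂ y v = 0}) (range_subset_iff.2 fun i => ?_)
    (isClosed_eq (by fun_prop) continuous_const) hy
  have : c ^ i * inner ℂ ((U ^ i) g) v = 0 := by
    rw [← inner_smul_right, ← zpow_apply_eq_smul hc hv, LinearIsometryEquiv.inner_map_map, hgv]
  exact (mul_eq_zero.1 this).resolve_left (zpow_ne_zero i hc)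

variable [CompleteSpace H] (U : H ≃ₗᵢ[ℂ] H)

theorem exists_eigenvector_inner_ne_zero {g : H} (hg : g ∈ almostPeriodicVectors U) (hg0 : g ≠ 0) :
    ∃ v, (∃ c : ℂ, U v = c • v) ∧ inner ℂ g v ≠ 0 := by
  set S : Set H := closure (range fun i : ℤ => (U ^ i) g)
  have hS : IsCompact S := hg
  have hS0 : 0 ∉ S := fun h =>
    hg0 (norm_eq_zero.1 (by simpa using (norm_eq_of_mem_closure_orbit h).symm))
  obtain ⟨A, hA, hAU⟩ := exists_mem_rankOneHull_commute U hS (range_nonempty _).closure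
    (mapsTo_closure_orbit U g)
  obtain ⟨v, hAv, c, hv⟩ := exists_common_eigenvector (isCompactOperator_of_mem_rankOneHull hA)
    (isSelfAdjoint_of_mem_rankOneHull hA).isSymmetric
    (ne_of_mem_of_not_mem hA (zero_notMem_rankOneHull hS hS0))
    (B := U.toLinearEquiv) (LinearMap.ext hAU)
  refine ⟨v, ⟨c, hv⟩, fun hgv => hAv ?_⟩
  exact apply_eq_zero_of_mem_rankOneHull hA fun y => inner_eq_zero_of_mem_closure_orbit hv hgv

theorem almostPeriodicVectors_eq_topologicalClosure_span :
    almostPeriodicVectors U =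
      (Submodule.span ℂ {f : H | f ≠ 0 ∧ ∃ c : ℂ, U f = c • f}).topologicalClosure := by
  set M := (Submodule.span ℂ {f : H | f ≠ 0 ∧ ∃ c : ℂ, U f = c • f}).topologicalClosure
  have hM : IsClosed (M : Set H) := Submodule.isClosed_topologicalClosure _
  have : CompleteSpace M := hM.completeSpace_coe
  have hle : M ≤ almostPeriodicVectors U :=
    Submodule.topologicalClosure_minimal _
      (Submodule.span_le.2 fun f ⟨_, _, hf⟩ => mem_almostPeriodicVectors_of_apply_eq_smul hf)
      isClosed_almostPeriodicVectors
  refine le_antisymm (fun f hf => ?_) hle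
  have hPf : M.starProjection f ∈ M := M.starProjection_apply_mem f
  suffices h : f - M.starProjection f = 0 from sub_eq_zero.1 h ▸ hPf
  by_contra hg0
  obtain ⟨v, hv, hgv⟩ := exists_eigenvector_inner_ne_zero U (sub_mem hf (hle hPf)) hg0
  have hv0 : v ≠ 0 := by
    rintro rfl
    exact hgv (inner_zero_right _)
  have hvM : v ∈ M := Submodule.le_topologicalClosure _ (Submodule.subset_span ⟨hv0, hv⟩)
  exact hgv (Submodule.inner_left_of_mem_orthogonal hvM (M.sub_starProjection_mem_orthogonal f))

end AlmostPeriodic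

section Measurability

variable {X : Type*} [MeasurableSpace X] {μ : Measure X}

theorem measurable_generatedBy {S : Set (Lp ℂ 2 μ)} {g : X → ℂ} (hg : Measurable g)
    {f : Lp ℂ 2 μ} (hf : f ∈ S) (hgf : g =ᵐ[μ] f) : Measurable[generatedBy S] g :=
  Measurable.of_comap_le (le_iSup₂_of_le g ⟨hg, f, hf, hgf⟩ le_rfl)

theorem generatedBy_le {X : Type*} {m : MeasurableSpace X} [MeasurableSpace X] {μ : Measure X}
    {S : Set (Lp ℂ 2 μ)}
    (h : ∀ g : X → ℂ, Measurable g → ∀ f ∈ S, g =ᵐ[μ] f → Measurable[m] g) :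
    generatedBy S ≤ m :=
  iSup₂_le fun g ⟨hg, f, hf, hgf⟩ => (h g hg f hf hgf).comap_le

theorem generatedBy_le_measurableSpace (S : Set (Lp ℂ 2 μ)) :
    generatedBy S ≤ ‹MeasurableSpace X› :=
  generatedBy_le fun _ hg _ _ _ => hg

theorem generatedBy_mono {S S' : Set (Lp ℂ 2 μ)} (h : S ⊆ S') : generatedBy S ≤ generatedBy S' :=
  generatedBy_le fun _ hg _ hf => measurable_generatedBy hg (h hf)

-- Such a `g` is the difference of two representatives of one class in `S`.
theorem measurable_generatedBy_of_ae_eq_zero {S : Set (Lp ℂ 2 μ)} (hS : S.Nonempty) {g : X → ℂ}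
    (hg : Measurable g) (hg0 : g =ᵐ[μ] 0) : Measurable[generatedBy S] g := by
  obtain ⟨f, hf⟩ := hS
  obtain ⟨f', hf', hff'⟩ := (Lp.aestronglyMeasurable f).aemeasurable
  have hsum : f' + g =ᵐ[μ] f := by simpa using hff'.symm.add hg0
  simpa using (measurable_generatedBy (hf'.add hg) hf hsum).sub
    (measurable_generatedBy hf' hf hff'.symm)

theorem aestronglyMeasurable_generatedBy_of_mem_closure_span {S : Set (Lp ℂ 2 μ)} {f : Lp ℂ 2 μ}
    (hf : f ∈ closure (Submodule.span ℂ S : Set (Lp ℂ 2 μ))) :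
    AEStronglyMeasurable[generatedBy S] f μ := by
  have hspan : Submodule.span ℂ S ≤ lpMeas ℂ ℂ (generatedBy S) 2 μ := by
    refine Submodule.span_le.2 fun f hf => mem_lpMeas_iff_aestronglyMeasurable.2 ?_
    obtain ⟨g, hg, hfg⟩ := (Lp.aestronglyMeasurable f).aemeasurable
    exact ⟨g, (measurable_generatedBy hg hf hfg.symm).stronglyMeasurable, hfg⟩
  exact closure_minimal (t := {f : Lp ℂ 2 μ | AEStronglyMeasurable[generatedBy S] f μ})
    (fun f hf => mem_lpMeas_iff_aestronglyMeasurable.1 (hspan hf))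
    (isClosed_aestronglyMeasurable (generatedBy_le_measurableSpace S)) hf

theorem generatedBy_closure_span {S : Set (Lp ℂ 2 μ)} (hS : S.Nonempty) :
    generatedBy (closure (Submodule.span ℂ S : Set (Lp ℂ 2 μ))) = generatedBy S := by
  refine le_antisymm (generatedBy_le fun g hg f hf hgf => ?_)
    (generatedBy_mono (Submodule.subset_span.trans subset_closure))
  obtain ⟨g', hg', hfg'⟩ := aestronglyMeasurable_generatedBy_of_mem_closure_span hf
  have hg'' : Measurable g' := hg'.measurable.mono (generatedBy_le_measurableSpace S) le_rfl
  have hdiff : g - g' =ᵐ[μ] 0 := (hgf.trans hfg').sub_eq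
  simpa using hg'.measurable.add
    (measurable_generatedBy_of_ae_eq_zero hS (hg.sub hg'') hdiff)

end Measurability

section Koopman

variable {X : Type*} [MeasurableSpace X] {μ : Measure X} (T : X ≃ᵐ X)
  (hT : MeasurePreserving T μ μ)

theorem compactVectors_eq_closure_span_eigenvectors :
    compactVectors T hT = closure (Submodule.span ℂ (eigenvectors T hT) : Set (Lp ℂ 2 μ)) :=
  congrArg SetLike.coe (almostPeriodicVectors_eq_topologicalClosure_span (koopman T hT))

theorem eigenvectors_nonempty [IsFiniteMeasure μ] [NeZero μ] : (eigenvectors T hT).Nonempty := by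
  refine ⟨Lp.const 2 μ (1 : ℂ), ?_, 1, ?_⟩
  · rw [← norm_ne_zero_iff, Lp.norm_const _ _ _ two_ne_zero]
    simp [measureReal_univ_ne_zero (μ := μ)]
  · have h := Lp.coeFn_const (p := 2) (μ := μ) (1 : ℂ)
    rw [one_smul]
    exact Lp.ext ((Lp.coeFn_compMeasurePreserving _ hT).trans
      ((hT.quasiMeasurePreserving.ae_eq_comp h).trans h.symm))

end Koopman

theorem theorem10p1_general {X : Type*} [MeasurableSpace X] {μ : Measure X}
    (T : X ≃ᵐ X) (hT : MeasurePreserving T μ μ) (hne : (eigenvectors T hT).Nonempty) :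
    kroneckerAlgebra T hT = compactFactor T hT ∧
    compactVectors T hT = closure (Submodule.span ℂ (eigenvectors T hT) : Set (Lp ℂ 2 μ)) := by
  have h := compactVectors_eq_closure_span_eigenvectors T hT
  refine ⟨?_, h⟩
  rw [compactFactor, h, generatedBy_closure_span hne]

theorem theorem10p1 {X : Type*} [MeasurableSpace X] (μ : Measure X) [IsProbabilityMeasure μ]
    (T : X ≃ᵐ X) (hT : MeasurePreserving T μ μ) :
    Kronecker.kroneckerAlgebra T hT = Kronecker.compactFactor T hT ∧
    Kronecker.compactVectors T hT =
      closure (Submodule.span ℂ (Kronecker.eigenvectors T hT) : Set (Lp ℂ 2 μ)) := by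
  exact theorem10p1_general T hT (eigenvectors_nonempty T hT)
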